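/- For $0\le k\le n$ write $\binom{[n]}{k}$ for the family of $k$-element subsets of $[n]=\{1,\dots,n\}$, and for $\mathcal F\subset\binom{[n]}{k}$ write $\mu(\mathcal F)=|\mathcal F|/\binom nk$. For $\mathcal F\subset\binom{[n]}{k}$ and an integer $0\le r\le n-k$, the $r$-fold iterated upper shadow of $\mathcal F$ is $$\partial^{+r}(\mathcal F)=\Big\{B\in\tbinom{[n]}{k+r}:\ B\supset A\text{ for some }A\in\mathcal F\Big\}.$$ There exist absolute constants $C>0$ and $c>0$ such that the following holds. Let $\epsilon\in(0,1)$, let $n$ be even, let $\mathcal A\subset\binom{[n]}{n/2}$ with $\mathcal A\ne\emptyset$ and $\mathcal A\ne\binom{[n]}{n/2}$, and let $\mathcal A^c=\binom{[n]}{n/2}\setminus\mathcal A$. Suppose that $$n\ \ge\ \frac{C}{\epsilon^2}\left(\log\frac1\epsilon+\log\frac{1}{\mu(\mathcal A)(1-\mu(\mathcal A))}\right).$$ Then, for $r=\lceil\epsilon\sqrt n\,\rceil$, $$\mu\big(\partial^{+r}(\mathcal A)\cap\partial^{+r}(\mathcal A^c)\big)\ \ge\ c\,\frac{\epsilon^2}{\log\left(\frac{1}{\epsilon\,\mu(\mathcal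 A)(1-\mu(\mathcal A))}\right)}\;\mu(\mathcal A)(1-\mu(\mathcal A)).$$ -/

import Mathlib

/-- The `k`th layer of the `n`-cube: all `k`-element subsets of an `n`-element set. -/
def cubeLayer (n k : ℕ) : Finset (Finset (Fin n)) :=
  Finset.powersetCard k Finset.univ

/-- The uniform measure `|F| / (n choose k)` of a family `F` contained in the `k`th layer of
the `n`-cube. -/
noncomputable def layerMeasure (n k : ℕ) (F : Finset (Finset (Fin n))) : ℝ :=
  (F.card : ℝ) / (n.choose k : ℝ)

/-!
Let `P` and `Q` be the sets of size `j + r` outside the upper shadow of `𝒜ᶜ`, respectively of `𝒜`;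
all the `j`-subsets of a member of `P` lie in `𝒜`, and those of a member of `Q` lie in `𝒜ᶜ`. So
members of `P` and `Q` intersect in fewer than `j` points, and the distance to `P`, truncated at
`r + 1`, is a function which is `0` on `P`, `r + 1` on `Q`, and which changes by at most `1`, and
only next to a set in neither family, when one element of a set is replaced. The spectral gap of
the walk that replaces one element bounds the variance of this function by its Dirichlet energy,
whence `r² μ(P) μ(Q) ≤ n μ(D)` for the remaining sets `D`, the intersection of the two shadows.
Upper shadows do not decrease the measure, so `μ(𝒜) μ(𝒜ᶜ) ≤ (1 - μ(Q)) (1 - μ(P))`, and the right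
side is `μ(P) μ(Q) + μ(D)`.
-/

section UpDown

open Finset

variable {α R : Type*} [DecidableEq α]

/-- The up operator on functions on the cube, which moves functions on the `k`th slice to
functions on the `(k + 1)`st. -/
def cubeUp [AddCommMonoid R] (f : Finset α → R) (S : Finset α) : R := ∑ x ∈ S, f (S.erase x)

variable [Fintype α]

/-- The down operator on functions on the cube, adjoint to `cubeUp`; it moves functions on the
`(k + 1)`st slice to functions on the `k`th. -/
def cubeDown [AddCommMonoid R] (f : Finset α → R) (S : Finset α) : R := ∑ x ∈ Sᶜ, f (insert x S)

theorem sum_powersetCard_sum_compl [AddCommMonoid R] (k : ℕ) (F : α → Finset α → R) :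
    ∑ S ∈ powersetCard k univ, ∑ x ∈ Sᶜ, F x S =
      ∑ T ∈ powersetCard (k + 1) univ, ∑ x ∈ T, F x (T.erase x) := by
  rw [sum_sigma', sum_sigma']
  refine sum_bij' (fun p _ => ⟨insert p.2 p.1, p.2⟩) (fun p _ => ⟨p.1.erase p.2, p.2⟩)
    ?_ ?_ ?_ ?_ ?_
  all_goals
    rintro ⟨S, x⟩ h
    simp only [mem_sigma, mem_powersetCard_univ, mem_compl] at h
    simp [h]

theorem sum_cubeDown_mul [NonUnitalNonAssocSemiring R] (k : ℕ) (f g : Finset α → R) :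
    ∑ S ∈ powersetCard k univ, cubeDown f S * g S =
      ∑ T ∈ powersetCard (k + 1) univ, f T * cubeUp g T := by
  simp only [cubeDown, cubeUp, sum_mul, mul_sum]
  rw [sum_powersetCard_sum_compl k fun x S => f (insert x S) * g S]
  exact sum_congr rfl fun T _ => sum_congr rfl fun x hx => by rw [insert_erase hx]

theorem sum_cubeDown [NonAssocSemiring R] (k : ℕ) (f : Finset α → R) :
    ∑ S ∈ powersetCard k univ, cubeDown f S = (k + 1) * ∑ T ∈ powersetCard (k + 1) univ, f T := by
  have h := sum_cubeDown_mul k f 1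
  simp only [Pi.one_apply, mul_one, cubeUp, sum_const, nsmul_eq_mul] at h
  rw [h, mul_sum]
  refine sum_congr rfl fun T hT => ?_
  rw [mem_powersetCard_univ.1 hT, ← Nat.cast_succ, (Nat.cast_commute _ (f T)).eq]

variable [CommRing R]

theorem cubeDown_cubeUp (f : Finset α → R) (S : Finset α) :
    cubeDown (cubeUp f) S = cubeUp (cubeDown f) S + ((Fintype.card α : R) - 2 * #S) * f S := by
  have hDU : cubeDown (cubeUp f) S = ∑ x ∈ Sᶜ, (f S + ∑ y ∈ S, f ((insert x S).erase y)) := by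
    refine sum_congr rfl fun x hx => ?_
    rw [cubeUp, sum_insert (mem_compl.1 hx), erase_insert (mem_compl.1 hx)]
  have hUD : cubeUp (cubeDown f) S = ∑ y ∈ S, (f S + ∑ x ∈ Sᶜ, f ((insert x S).erase y)) := by
    refine sum_congr rfl fun y hy => ?_
    rw [cubeDown, compl_erase, sum_insert (notMem_compl.2 hy), insert_erase hy]
    congr 1
    refine sum_congr rfl fun x hx => ?_
    rw [erase_insert_of_ne (ne_of_mem_of_not_mem hy (mem_compl.1 hx)).symm]
  rw [hDU, hUD, sum_add_distrib, sum_add_distrib, sum_comm]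
  simp only [sum_const, nsmul_eq_mul]
  rw [card_compl, Nat.cast_sub (card_le_univ S)]
  ring

theorem sum_cubeUp_sq (k : ℕ) (g : Finset α → R) :
    ∑ T ∈ powersetCard (k + 2) univ, cubeUp g T ^ 2 =
      ∑ S ∈ powersetCard k univ, cubeDown g S ^ 2 +
        ((Fintype.card α : R) - 2 * (k + 1)) * ∑ S ∈ powersetCard (k + 1) univ, g S ^ 2 := by
  simp only [sq (cubeUp g _), sq (cubeDown g _)]
  rw [← sum_cubeDown_mul (k + 1), sum_cubeDown_mul k, mul_sum, ← sum_add_distrib]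
  refine sum_congr rfl fun S hS => ?_
  rw [cubeDown_cubeUp, mem_powersetCard_univ.1 hS]
  push_cast
  ring

end UpDown

section Poincare

open Finset

variable {α R : Type*}

theorem sum_sum_sub_sq [CommRing R] (s : Finset α) (f : α → R) :
    ∑ i ∈ s, ∑ j ∈ s, (f i - f j) ^ 2 = 2 * (#s * ∑ i ∈ s, f i ^ 2 - (∑ i ∈ s, f i) ^ 2) := by
  simp only [sub_sq, sum_add_distrib, sum_sub_distrib, sum_const, nsmul_eq_mul, ← mul_sum,
    ← sum_mul]
  ring

theorem two_mul_card_mul_card_mul_sq_le [CommRing R] [LinearOrder R] [IsStrictOrderedRing R]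
    {s P Q : Finset α} (hP : P ⊆ s) (hQ : Q ⊆ s) (hPQ : Disjoint P Q)
    {f : α → R} {a b : R} (ha : ∀ i ∈ P, f i = a) (hb : ∀ i ∈ Q, f i = b) :
    2 * (#P * #Q * (a - b) ^ 2) ≤ ∑ i ∈ s, ∑ j ∈ s, (f i - f j) ^ 2 := by
  classical
  have hsubset : ∀ {u : Finset α}, u ⊆ s → ∀ i, ∑ j ∈ u, (f i - f j) ^ 2 ≤
      ∑ j ∈ s, (f i - f j) ^ 2 := fun hu i =>
    sum_le_sum_of_subset_of_nonneg hu fun _ _ _ => sq_nonneg _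
  have hrowP : ∀ i ∈ P, #Q * (a - b) ^ 2 ≤ ∑ j ∈ s, (f i - f j) ^ 2 := fun i hi => by
    rw [← nsmul_eq_mul, ← sum_const]
    exact (sum_congr rfl fun j hj => by rw [ha i hi, hb j hj]).trans_le (hsubset hQ i)
  have hrowQ : ∀ i ∈ Q, #P * (a - b) ^ 2 ≤ ∑ j ∈ s, (f i - f j) ^ 2 := fun i hi => by
    rw [← nsmul_eq_mul, ← sum_const]
    exact (sum_congr rfl fun j hj => by rw [hb i hi, ha j hj, sub_sq_comm]).trans_le
      (hsubset hP i)
  calc 2 * (#P * #Q * (a - b) ^ 2)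
      = ∑ _i ∈ P, #Q * (a - b) ^ 2 + ∑ _i ∈ Q, #P * (a - b) ^ 2 := by
        simp only [sum_const, nsmul_eq_mul]
        ring
    _ ≤ ∑ i ∈ P, ∑ j ∈ s, (f i - f j) ^ 2 + ∑ i ∈ Q, ∑ j ∈ s, (f i - f j) ^ 2 :=
        add_le_add (sum_le_sum hrowP) (sum_le_sum hrowQ)
    _ = ∑ i ∈ P ∪ Q, ∑ j ∈ s, (f i - f j) ^ 2 := (sum_union hPQ).symm
    _ ≤ ∑ i ∈ s, ∑ j ∈ s, (f i - f j) ^ 2 :=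
        sum_le_sum_of_subset_of_nonneg (union_subset hP hQ) fun _ _ _ =>
          sum_nonneg fun _ _ => sq_nonneg _

variable [DecidableEq α] [Fintype α]

/-- The Dirichlet energy, on the `(k + 1)`st slice, of the walk that removes an element from a set
and then inserts one. -/
def sliceEnergy [CommRing R] (k : ℕ) (f : Finset α → R) : R :=
  ∑ S ∈ powersetCard k univ, ∑ x ∈ Sᶜ, ∑ y ∈ Sᶜ, (f (insert x S) - f (insert y S)) ^ 2

theorem sliceEnergy_eq [CommRing R] (k : ℕ) (f : Finset α → R) :
    sliceEnergy k f =
      2 * (((Fintype.card α : R) - k) * (k + 1) * ∑ T ∈ powersetCard (k + 1) univ, f T ^ 2 -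
        ∑ S ∈ powersetCard k univ, cubeDown f S ^ 2) := by
  rw [mul_assoc _ ((k : R) + 1), ← sum_cubeDown, mul_sum, ← sum_sub_distrib, mul_sum]
  refine sum_congr rfl fun S hS => ?_
  rw [sum_sum_sub_sq, card_compl, Nat.cast_sub (card_le_univ S), mem_powersetCard_univ.1 hS]
  rfl

theorem sum_cubeDown_sq_le [CommRing R] [LinearOrder R] [IsStrictOrderedRing R] (k : ℕ)
    {f : Finset α → R} (h0 : ∑ T ∈ powersetCard (k + 1) univ, f T = 0) :
    ∑ S ∈ powersetCard k univ, cubeDown f S ^ 2 ≤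
      k * ((Fintype.card α : R) - (k + 1)) * ∑ T ∈ powersetCard (k + 1) univ, f T ^ 2 := by
  induction k generalizing f with
  | zero =>
    have hempty : cubeDown f ∅ = 0 := by simpa [h0] using sum_cubeDown 0 f
    simp [hempty]
  | succ k ih =>
    set F := ∑ T ∈ powersetCard (k + 1 + 1) univ, f T ^ 2
    set G := ∑ S ∈ powersetCard (k + 1) univ, cubeDown f S ^ 2
    have hUp : ∑ T ∈ powersetCard (k + 1 + 1) univ, cubeUp (cubeDown f) T ^ 2 ≤
        (k + 1) * ((Fintype.card α : R) - (k + 2)) * G := by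
      rw [sum_cubeUp_sq]
      linarith [ih (by rw [sum_cubeDown, h0, mul_zero])]
    have hCS : G ^ 2 ≤ F * ∑ T ∈ powersetCard (k + 1 + 1) univ, cubeUp (cubeDown f) T ^ 2 := by
      have := sum_mul_sq_le_sq_mul_sq (powersetCard (k + 1 + 1) univ) f (cubeUp (cubeDown f))
      simpa only [← sum_cubeDown_mul, ← sq] using this
    have hF : 0 ≤ F := sum_nonneg fun _ _ => sq_nonneg _
    have hG : 0 ≤ G := sum_nonneg fun _ _ => sq_nonneg _
    have hRHS : 0 ≤ (k + 1) * ((Fintype.card α : R) - (k + 2)) * F := by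
      rcases le_or_gt (k + 2) (Fintype.card α) with hk | hk
      · have : ((k : R) + 2) ≤ Fintype.card α := mod_cast hk
        have := sub_nonneg.2 this
        positivity
      · have : F = 0 := by
          rw [show F = ∑ T ∈ powersetCard (k + 1 + 1) univ, f T ^ 2 from rfl,
            powersetCard_eq_empty.2 (by rwa [card_univ]), sum_empty]
        rw [this, mul_zero]
    have hle : G ≤ (k + 1) * ((Fintype.card α : R) - (k + 2)) * F := by
      rcases hG.eq_or_lt with hG0 | hGpos
      · rwa [← hG0]
      · refine le_of_mul_le_mul_right ?_ hGpos
        linarith [hCS.trans (mul_le_mul_of_nonneg_left hUp hF)]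
    push_cast
    linarith

theorem two_mul_card_mul_sum_sq_le_sliceEnergy [CommRing R] [LinearOrder R]
    [IsStrictOrderedRing R] (k : ℕ) {f : Finset α → R}
    (h0 : ∑ T ∈ powersetCard (k + 1) univ, f T = 0) :
    2 * (Fintype.card α * ∑ T ∈ powersetCard (k + 1) univ, f T ^ 2) ≤ sliceEnergy k f := by
  rw [sliceEnergy_eq]
  linarith [sum_cubeDown_sq_le k h0]

theorem slice_poincare [Field R] [LinearOrder R] [IsStrictOrderedRing R] (k : ℕ)
    (f : Finset α → R) :
    Fintype.card α * ∑ S ∈ powersetCard (k + 1) univ, ∑ T ∈ powersetCard (k + 1) univ,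
        (f S - f T) ^ 2 ≤
      (Fintype.card α).choose (k + 1) * sliceEnergy k f := by
  set L : Finset (Finset α) := powersetCard (k + 1) univ
  have hL : #L = (Fintype.card α).choose (k + 1) := by rw [card_powersetCard, card_univ]
  rcases L.eq_empty_or_nonempty with hempty | hne
  · rw [← hL]
    simp [hempty]
  have hL0 : (#L : R) ≠ 0 := Nat.cast_ne_zero.2 (card_ne_zero.2 hne)
  set g : Finset α → R := fun S => f S - (∑ T ∈ L, f T) / #L
  have hg0 : ∑ S ∈ L, g S = 0 := by
    rw [sum_sub_distrib, sum_const, nsmul_eq_mul, mul_div_cancel₀ _ hL0, sub_self]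
  have hgf : ∀ S T, f S - f T = g S - g T := fun S T => (sub_sub_sub_cancel_right _ _ _).symm
  have henergy : sliceEnergy k f = sliceEnergy k g := by simp only [sliceEnergy, hgf]
  have hg := mul_le_mul_of_nonneg_left (two_mul_card_mul_sum_sq_le_sliceEnergy k hg0)
    (Nat.cast_nonneg (α := R) #L)
  simp only [hgf]
  rw [sum_sum_sub_sq, hg0, henergy, ← hL]
  linarith

end Poincare

section Separated

open Finset

variable {α : Type*} [DecidableEq α]

/-- The number of elements of `T` outside the nearest member of `P`, truncated at `s`. For sets of
equal size it is a distance in the graph whose edges replace one element. -/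
def truncDist (P : Finset (Finset α)) (s : ℕ) (T : Finset α) : ℕ :=
  P.fold min s fun B => #(T \ B)

variable {P Q : Finset (Finset α)} {s : ℕ}

theorem truncDist_insert_le (P : Finset (Finset α)) (s : ℕ) (S : Finset α) (x y : α) :
    truncDist P s (insert x S) ≤ truncDist P s (insert y S) + 1 := by
  rw [truncDist, fold_min_le]
  rcases (fold_min_le (truncDist P s (insert y S))).1 le_rfl with h | ⟨B, hB, h⟩
  · exact Or.inl (h.trans (Nat.le_succ _))
  · have hsub : insert x S \ B ⊆ insert x (insert y S \ B) := by grind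
    exact Or.inr ⟨B, hB,
      (card_le_card hsub).trans ((card_insert_le _ _).trans (Nat.succ_le_succ h))⟩

theorem truncDist_of_mem {T : Finset α} (hT : T ∈ P) : truncDist P s T = 0 := by
  rw [← Nat.le_zero, truncDist, fold_min_le]
  exact Or.inr ⟨T, hT, by simp⟩

theorem truncDist_of_forall_le {T : Finset α} (hT : ∀ B ∈ P, s ≤ #(T \ B)) :
    truncDist P s T = s :=
  le_antisymm ((fold_min_le s).2 (Or.inl le_rfl)) ((le_fold_min s).2 ⟨le_rfl, hT⟩)

theorem abs_truncDist_sub_le (P : Finset (Finset α)) (s : ℕ) (S : Finset α) (x y : α) :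
    |(truncDist P s (insert x S) : ℝ) - truncDist P s (insert y S)| ≤ 1 := by
  have hxy : (truncDist P s (insert x S) : ℝ) ≤ truncDist P s (insert y S) + 1 :=
    mod_cast truncDist_insert_le P s S x y
  have hyx : (truncDist P s (insert y S) : ℝ) ≤ truncDist P s (insert x S) + 1 :=
    mod_cast truncDist_insert_le P s S y x
  rw [abs_le]
  constructor <;> linarith

theorem card_insert_sdiff_insert_le_one (S : Finset α) (x y : α) :
    #(insert x S \ insert y S) ≤ 1 :=
  (card_le_card (show insert x S \ insert y S ⊆ {x} by grind)).trans (card_singleton x).le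

theorem truncDist_insert_eq (hs : 1 < s) (hsep : ∀ B ∈ P, ∀ T ∈ Q, s ≤ #(T \ B)) {S : Finset α}
    {x y : α} (hx : insert x S ∈ P ∪ Q) (hy : insert y S ∈ P ∪ Q) :
    truncDist P s (insert x S) = truncDist P s (insert y S) := by
  have hclose : ∀ u v, ¬ s ≤ #(insert u S \ insert v S) := fun u v =>
    ((card_insert_sdiff_insert_le_one S u v).trans_lt hs).not_ge
  rcases mem_union.1 hx with hx | hx <;> rcases mem_union.1 hy with hy | hy
  · rw [truncDist_of_mem hx, truncDist_of_mem hy]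
  · exact absurd (hsep _ hx _ hy) (hclose y x)
  · exact absurd (hsep _ hy _ hx) (hclose x y)
  · rw [truncDist_of_forall_le fun B hB => hsep B hB _ hx,
      truncDist_of_forall_le fun B hB => hsep B hB _ hy]

variable [Fintype α]

theorem sliceEnergy_le_of_eq_off {R : Type*} [CommRing R] [LinearOrder R] [IsStrictOrderedRing R]
    {k : ℕ} {f : Finset α → R} {D : Finset (Finset α)} (hD : D ⊆ powersetCard (k + 1) univ)
    (hlip : ∀ S x y, |f (insert x S) - f (insert y S)| ≤ 1)
    (heq : ∀ S, #S = k → ∀ x ∉ S, ∀ y ∉ S, insert x S ∉ D → insert y S ∉ D →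
      f (insert x S) = f (insert y S)) :
    sliceEnergy k f ≤ 2 * (((Fintype.card α : R) - k) * ((k + 1) * #D)) := by
  set χ : Finset α → R := fun S => if S ∈ D then 1 else 0
  have hχ : ∀ S, 0 ≤ χ S := fun S => by
    dsimp only [χ]
    split_ifs <;> norm_num
  have hedge : ∀ S ∈ powersetCard k univ, ∀ x ∈ Sᶜ, ∀ y ∈ Sᶜ,
      (f (insert x S) - f (insert y S)) ^ 2 ≤ χ (insert x S) + χ (insert y S) := by
    intro S hS x hx y hy
    have hle := (sq_le_one_iff_abs_le_one _).2 (hlip S x y)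
    by_cases hxD : insert x S ∈ D
    · exact hle.trans (by simpa [χ, hxD] using hχ (insert y S))
    by_cases hyD : insert y S ∈ D
    · exact hle.trans (by simpa [χ, hyD] using hχ (insert x S))
    rw [heq S (mem_powersetCard_univ.1 hS) x (mem_compl.1 hx) y (mem_compl.1 hy) hxD hyD]
    simpa using add_nonneg (hχ (insert x S)) (hχ (insert y S))
  have hrow : ∀ S ∈ powersetCard k univ, ∑ x ∈ Sᶜ, ∑ y ∈ Sᶜ, (χ (insert x S) + χ (insert y S)) =
      2 * (((Fintype.card α : R) - k) * cubeDown χ S) := by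
    intro S hS
    simp only [sum_add_distrib, sum_const, nsmul_eq_mul, ← mul_sum]
    rw [← cubeDown, card_compl, Nat.cast_sub (card_le_univ S), mem_powersetCard_univ.1 hS]
    ring
  have hχsum : ∑ T ∈ powersetCard (k + 1) univ, χ T = #D := by
    rw [sum_ite_mem, inter_eq_right.2 hD, sum_const, nsmul_one]
  calc sliceEnergy k f
      ≤ ∑ S ∈ powersetCard k univ, ∑ x ∈ Sᶜ, ∑ y ∈ Sᶜ, (χ (insert x S) + χ (insert y S)) :=
        sum_le_sum fun S hS => sum_le_sum fun x hx => sum_le_sum fun y hy => hedge S hS x hx y hy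
    _ = 2 * (((Fintype.card α : R) - k) * ((k + 1) * #D)) := by
        rw [sum_congr rfl hrow, ← mul_sum, ← mul_sum, sum_cubeDown, hχsum]

theorem card_mul_card_le_of_separated {k : ℕ} (hs : 1 < s) (hP : P ⊆ powersetCard (k + 1) univ)
    (hQ : Q ⊆ powersetCard (k + 1) univ) (hsep : ∀ B ∈ P, ∀ T ∈ Q, s ≤ #(T \ B)) :
    (Fintype.card α : ℝ) * s ^ 2 * (#P * #Q) ≤
      ((Fintype.card α : ℝ) - k) * (k + 1) * #(powersetCard (k + 1) univ \ (P ∪ Q)) *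
        (Fintype.card α).choose (k + 1) := by
  set f : Finset α → ℝ := fun T => truncDist P s T
  have hdisj : Disjoint P Q := disjoint_left.2 fun T hTP hTQ => by
    have := hsep T hTP T hTQ
    rw [sdiff_self, bot_eq_empty, card_empty] at this
    omega
  have hvariance := two_mul_card_mul_card_mul_sq_le hP hQ hdisj (f := f) (a := 0) (b := s)
    (fun T hT => by simp [f, truncDist_of_mem hT])
    (fun T hT => by simp [f, truncDist_of_forall_le fun B hB => hsep B hB T hT])
  have hlayer : ∀ {S : Finset α}, #S = k → ∀ x ∉ S,
      insert x S ∉ powersetCard (k + 1) univ \ (P ∪ Q) → insert x S ∈ P ∪ Q := fun hS x hx h => by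
    by_contra hPQ
    exact h (mem_sdiff.2 ⟨mem_powersetCard_univ.2 (by rw [card_insert_of_notMem hx, hS]), hPQ⟩)
  have henergy := sliceEnergy_le_of_eq_off (f := f) (sdiff_subset (t := P ∪ Q))
    (abs_truncDist_sub_le P s) fun S hS x hx y hy hxD hyD =>
      congrArg (Nat.cast (R := ℝ))
        (truncDist_insert_eq hs hsep (hlayer hS x hx hxD) (hlayer hS y hy hyD))
  have hpoincare := (mul_le_mul_of_nonneg_left hvariance (Nat.cast_nonneg _)).trans
    ((slice_poincare k f).trans (mul_le_mul_of_nonneg_left henergy (Nat.cast_nonneg _)))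
  linarith

end Separated

section Shadow

open Finset
open scoped FinsetFamily

variable {α : Type*} [DecidableEq α] [Fintype α] {A : Finset (Finset α)} {j r : ℕ}

theorem sized_upShadow_iterate (hA : (A : Set (Finset α)).Sized j) (r : ℕ) :
    (∂⁺ ^[r] A : Set (Finset α)).Sized (j + r) := by
  intro T hT
  obtain ⟨X, hX, -, hcard⟩ := mem_upShadow_iterate_iff_exists_mem_card_add.1 (mem_coe.1 hT)
  rw [hcard, hA hX]

theorem card_div_choose_le_card_upShadow_div_choose {𝕜 : Type*} [Semifield 𝕜] [LinearOrder 𝕜]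
    [IsStrictOrderedRing 𝕜] (hj : j + 1 ≤ Fintype.card α) (hA : (A : Set (Finset α)).Sized j) :
    (#A : 𝕜) / (Fintype.card α).choose j ≤ #(∂⁺ A) / (Fintype.card α).choose (j + 1) := by
  have hcompls : (Aᶜˢ : Set (Finset α)).Sized (Fintype.card α - j) := fun S hS => by
    rw [← compl_compl S, card_compl, hA (mem_compls.1 hS)]
  have hlym := local_lubell_yamamoto_meshalkin_inequality_div (𝕜 := 𝕜) (by omega) hcompls
  rwa [shadow_compls, card_compls, card_compls, Nat.choose_symm (by omega), Nat.sub_sub,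
    Nat.choose_symm hj] at hlym

theorem card_div_choose_le_card_upShadow_iterate_div_choose {𝕜 : Type*} [Semifield 𝕜]
    [LinearOrder 𝕜] [IsStrictOrderedRing 𝕜] (hr : j + r ≤ Fintype.card α)
    (hA : (A : Set (Finset α)).Sized j) :
    (#A : 𝕜) / (Fintype.card α).choose j ≤ #(∂⁺ ^[r] A) / (Fintype.card α).choose (j + r) := by
  induction r with
  | zero => simp
  | succ r ih =>
    rw [Function.iterate_succ_apply']
    exact (ih (by omega)).trans
      (card_div_choose_le_card_upShadow_div_choose hr (sized_upShadow_iterate hA r))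

theorem lt_card_sdiff_of_notMem_upShadow_iterate {B T : Finset α} (hB : #B = j + r)
    (hT : #T = j + r) (hBA : B ∉ ∂⁺ ^[r] (powersetCard j univ \ A)) (hTA : T ∉ ∂⁺ ^[r] A) :
    r < #(T \ B) := by
  by_contra! hle
  have hinter : j ≤ #(T ∩ B) := by
    have := card_sdiff_add_card_inter T B
    omega
  obtain ⟨X, hXTB, hX⟩ := exists_subset_card_eq hinter
  obtain ⟨hXT, hXB⟩ := subset_inter_iff.1 hXTB
  by_cases hXA : X ∈ A
  · exact hTA (mem_upShadow_iterate_iff_exists_mem_card_add.2 ⟨X, hXA, hXT, by omega⟩)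
  · exact hBA (mem_upShadow_iterate_iff_exists_mem_card_add.2
      ⟨X, mem_sdiff.2 ⟨mem_powersetCard_univ.2 hX, hXA⟩, hXB, by omega⟩)

theorem upShadow_iterate_union_upShadow_iterate_sdiff (hA : (A : Set (Finset α)).Sized j) (r : ℕ) :
    ∂⁺ ^[r] A ∪ ∂⁺ ^[r] (powersetCard j univ \ A) = powersetCard (j + r) univ := by
  have hAc : ((powersetCard j univ \ A : Finset (Finset α)) : Set (Finset α)).Sized j :=
    subset_powersetCard_univ_iff.1 sdiff_subset
  refine (union_subset ?_ ?_).antisymm fun T hT => ?_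
  · exact subset_powersetCard_univ_iff.2 (sized_upShadow_iterate hA r)
  · exact subset_powersetCard_univ_iff.2 (sized_upShadow_iterate hAc r)
  · rw [mem_powersetCard_univ] at hT
    by_contra hTU
    rw [mem_union, not_or] at hTU
    simpa using lt_card_sdiff_of_notMem_upShadow_iterate hT hT hTU.2 hTU.1

end Shadow

section LayerMeasure

open Finset
open scoped FinsetFamily

variable {n j k r s : ℕ} {A P Q : Finset (Finset (Fin n))}

theorem layerMeasure_nonneg (n k : ℕ) (F : Finset (Finset (Fin n))) : 0 ≤ layerMeasure n k F := by
  unfold layerMeasure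
  positivity

theorem layerMeasure_sdiff (hk : k ≤ n) (hA : A ⊆ cubeLayer n k) :
    layerMeasure n k (cubeLayer n k \ A) = 1 - layerMeasure n k A := by
  have hM : (n.choose k : ℝ) ≠ 0 := Nat.cast_ne_zero.2 (Nat.choose_pos hk).ne'
  rw [layerMeasure, card_sdiff_of_subset hA, Nat.cast_sub (card_le_card hA), cubeLayer,
    card_powersetCard, card_univ, Fintype.card_fin, sub_div, div_self hM, layerMeasure]

theorem layerMeasure_le_one (hk : k ≤ n) (hA : A ⊆ cubeLayer n k) : layerMeasure n k A ≤ 1 :=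
  sub_nonneg.1 (layerMeasure_sdiff hk hA ▸ layerMeasure_nonneg n k _)

theorem layerMeasure_self (hk : k ≤ n) : layerMeasure n k (cubeLayer n k) = 1 := by
  simpa [layerMeasure] using layerMeasure_sdiff hk (empty_subset (cubeLayer n k))

theorem layerMeasure_add_layerMeasure (n k : ℕ) (P Q : Finset (Finset (Fin n))) :
    layerMeasure n k P + layerMeasure n k Q =
      layerMeasure n k (P ∪ Q) + layerMeasure n k (P ∩ Q) := by
  simp only [layerMeasure, ← add_div]
  exact congrArg (· / _) (mod_cast (card_union_add_card_inter P Q).symm)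

theorem layerMeasure_pos (hk : k ≤ n) (hA : A.Nonempty) : 0 < layerMeasure n k A :=
  div_pos (Nat.cast_pos.2 hA.card_pos) (Nat.cast_pos.2 (Nat.choose_pos hk))

theorem layerMeasure_mul_one_sub_pos (hk : k ≤ n) (hA : A ⊆ cubeLayer n k) (hne : A ≠ ∅)
    (hne' : A ≠ cubeLayer n k) : 0 < layerMeasure n k A * (1 - layerMeasure n k A) := by
  rw [← layerMeasure_sdiff hk hA]
  exact mul_pos (layerMeasure_pos hk (nonempty_iff_ne_empty.2 hne))
    (layerMeasure_pos hk (sdiff_nonempty.2 fun h => hne' (hA.antisymm h)))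

theorem upShadow_iterate_subset_cubeLayer (hA : A ⊆ cubeLayer n j) (r : ℕ) :
    ∂⁺ ^[r] A ⊆ cubeLayer n (j + r) :=
  subset_powersetCard_univ_iff.2 (sized_upShadow_iterate (subset_powersetCard_univ_iff.1 hA) r)

theorem layerMeasure_upShadow_iterate_add (hjr : j + r ≤ n) (hA : A ⊆ cubeLayer n j) :
    layerMeasure n (j + r) (∂⁺ ^[r] A) + layerMeasure n (j + r) (∂⁺ ^[r] (cubeLayer n j \ A)) =
      1 + layerMeasure n (j + r) (∂⁺ ^[r] A ∩ ∂⁺ ^[r] (cubeLayer n j \ A)) := by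
  rw [layerMeasure_add_layerMeasure, cubeLayer, upShadow_iterate_union_upShadow_iterate_sdiff
    (subset_powersetCard_univ_iff.1 hA), ← cubeLayer, ← cubeLayer, layerMeasure_self hjr]

theorem layerMeasure_le_layerMeasure_upShadow_iterate (hjr : j + r ≤ n) (hA : A ⊆ cubeLayer n j) :
    layerMeasure n j A ≤ layerMeasure n (j + r) (∂⁺ ^[r] A) := by
  simpa only [layerMeasure, Fintype.card_fin] using
    card_div_choose_le_card_upShadow_iterate_div_choose (𝕜 := ℝ) (α := Fin n)
      (by rwa [Fintype.card_fin]) (subset_powersetCard_univ_iff.1 hA)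

theorem sq_mul_layerMeasure_mul_le_of_separated (hk : k + 1 ≤ n) (hs : 1 < s)
    (hP : P ⊆ cubeLayer n (k + 1)) (hQ : Q ⊆ cubeLayer n (k + 1))
    (hsep : ∀ B ∈ P, ∀ T ∈ Q, s ≤ #(T \ B)) :
    s ^ 2 * (layerMeasure n (k + 1) P * layerMeasure n (k + 1) Q) ≤
      n * layerMeasure n (k + 1) (cubeLayer n (k + 1) \ (P ∪ Q)) := by
  have hM : (0 : ℝ) < n.choose (k + 1) := Nat.cast_pos.2 (Nat.choose_pos hk)
  have hk' : ((k : ℝ) + 1) ≤ n := mod_cast hk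
  have hn : (0 : ℝ) < n := by linarith [k.cast_nonneg (α := ℝ)]
  have hcard := card_mul_card_le_of_separated hs hP hQ hsep
  rw [Fintype.card_fin, ← cubeLayer] at hcard
  have hdegree : ((n : ℝ) - k) * (k + 1) ≤ n * n :=
    mul_le_mul (sub_le_self _ k.cast_nonneg) hk' (by positivity) hn.le
  have hcoarse : (s : ℝ) ^ 2 * (#P * #Q) ≤
      n * #(cubeLayer n (k + 1) \ (P ∪ Q)) * n.choose (k + 1) := by
    refine le_of_mul_le_mul_left ?_ hn
    calc (n : ℝ) * ((s : ℝ) ^ 2 * (#P * #Q)) = (n : ℝ) * s ^ 2 * (#P * #Q) := by ring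
      _ ≤ (n : ℝ) * n * #(cubeLayer n (k + 1) \ (P ∪ Q)) * n.choose (k + 1) :=
        hcard.trans (by gcongr)
      _ = (n : ℝ) * (n * #(cubeLayer n (k + 1) \ (P ∪ Q)) * n.choose (k + 1)) := by ring
  simp only [layerMeasure]
  rw [div_mul_div_comm, ← mul_div_assoc, ← mul_div_assoc, div_le_div_iff₀ (mul_pos hM hM) hM]
  linarith [mul_le_mul_of_nonneg_right hcoarse hM.le]

theorem sq_mul_one_sub_layerMeasure_upShadow_mul_le (hr : 0 < r) (hjr : j + r ≤ n)
    (hA : A ⊆ cubeLayer n j) :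
    ((r : ℝ) + 1) ^ 2 * ((1 - layerMeasure n (j + r) (∂⁺ ^[r] (cubeLayer n j \ A))) *
        (1 - layerMeasure n (j + r) (∂⁺ ^[r] A))) ≤
      n * layerMeasure n (j + r) (∂⁺ ^[r] A ∩ ∂⁺ ^[r] (cubeLayer n j \ A)) := by
  obtain ⟨i, rfl⟩ := Nat.exists_eq_add_of_le' hr
  set L := cubeLayer n (j + (i + 1))
  set U := ∂⁺ ^[i + 1] A
  set U' := ∂⁺ ^[i + 1] (cubeLayer n j \ A)
  have hU : U ⊆ L := upShadow_iterate_subset_cubeLayer hA (i + 1)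
  have hU' : U' ⊆ L := upShadow_iterate_subset_cubeLayer sdiff_subset (i + 1)
  have hsep : ∀ B ∈ L \ U', ∀ T ∈ L \ U, i + 1 + 1 ≤ #(T \ B) := fun B hB T hT => by
    rw [mem_sdiff] at hB hT
    exact lt_card_sdiff_of_notMem_upShadow_iterate (mem_powersetCard_univ.1 hB.1)
      (mem_powersetCard_univ.1 hT.1) hB.2 hT.2
  have hrest : L \ (L \ U' ∪ L \ U) = U ∩ U' := by grind
  have hmain := sq_mul_layerMeasure_mul_le_of_separated hjr (by omega) sdiff_subset sdiff_subset
    hsep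
  rw [← layerMeasure_sdiff hjr hU',
    ← layerMeasure_sdiff hjr hU, ← hrest]
  exact_mod_cast hmain

theorem sq_mul_layerMeasure_mul_one_sub_le (hr : 0 < r) (hjr : j + r ≤ n)
    (hA : A ⊆ cubeLayer n j) :
    r ^ 2 * (layerMeasure n j A * (1 - layerMeasure n j A)) ≤
      (r ^ 2 + n) * layerMeasure n (j + r) (∂⁺ ^[r] A ∩ ∂⁺ ^[r] (cubeLayer n j \ A)) := by
  have hsep := sq_mul_one_sub_layerMeasure_upShadow_mul_le hr hjr hA
  have hgrow := layerMeasure_le_layerMeasure_upShadow_iterate hjr hA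
  have hgrow' := layerMeasure_le_layerMeasure_upShadow_iterate hjr
    (sdiff_subset : cubeLayer n j \ A ⊆ _)
  have hadd := layerMeasure_upShadow_iterate_add hjr hA
  have hq := layerMeasure_le_one hjr (upShadow_iterate_subset_cubeLayer hA r)
  have hp := layerMeasure_le_one hjr
    (upShadow_iterate_subset_cubeLayer (sdiff_subset : cubeLayer n j \ A ⊆ _) r)
  rw [layerMeasure_sdiff (by omega) hA] at hgrow'
  have ha := layerMeasure_le_one (by omega) hA
  set a := layerMeasure n j A
  set u := layerMeasure n (j + r) (∂⁺ ^[r] A)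
  set v := layerMeasure n (j + r) (∂⁺ ^[r] (cubeLayer n j \ A))
  set d := layerMeasure n (j + r) (∂⁺ ^[r] A ∩ ∂⁺ ^[r] (cubeLayer n j \ A))
  have hweaken : (r : ℝ) ^ 2 * ((1 - v) * (1 - u)) ≤ (r + 1) ^ 2 * ((1 - v) * (1 - u)) :=
    mul_le_mul_of_nonneg_right (by gcongr; linarith)
      (mul_nonneg (sub_nonneg.2 hp) (sub_nonneg.2 hq))
  calc (r : ℝ) ^ 2 * (a * (1 - a)) ≤ r ^ 2 * (u * v) := by
        gcongr
        exact layerMeasure_nonneg _ _ _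
    _ = r ^ 2 * ((1 - v) * (1 - u)) + r ^ 2 * d := by linear_combination r ^ 2 * hadd
    _ ≤ (r ^ 2 + n) * d := by linarith

theorem theorem1_general {ε : ℝ} (hε : 0 ≤ ε) (hr : 0 < r) (hεr : ε * √(n : ℝ) ≤ r)
    (hjr : j + r ≤ n) (hA : A ⊆ cubeLayer n j) :
    ε ^ 2 * (layerMeasure n j A * (1 - layerMeasure n j A)) ≤
      (1 + ε ^ 2) * layerMeasure n (j + r) (∂⁺ ^[r] A ∩ ∂⁺ ^[r] (cubeLayer n j \ A)) := by
  have hsq : ε ^ 2 * n ≤ (r : ℝ) ^ 2 := by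
    rw [← Real.sq_sqrt n.cast_nonneg, ← mul_pow]
    exact pow_le_pow_left₀ (by positivity) hεr 2
  have hd := layerMeasure_nonneg n (j + r) (∂⁺ ^[r] A ∩ ∂⁺ ^[r] (cubeLayer n j \ A))
  have hmain := mul_le_mul_of_nonneg_left (sq_mul_layerMeasure_mul_one_sub_le hr hjr hA)
    (sq_nonneg ε)
  have hr2 : (0 : ℝ) < r ^ 2 := by positivity
  refine le_of_mul_le_mul_left ?_ hr2
  linarith [mul_le_mul_of_nonneg_right hsq hd]

end LayerMeasure

section Numerics

theorem one_le_log_one_div {x : ℝ} (hx : 0 < x) (hx4 : x ≤ 1 / 4) : 1 ≤ Real.log (1 / x) := by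
  rw [Real.le_log_iff_exp_le (by positivity), le_div_iff₀ hx]
  nlinarith [Real.exp_one_lt_three, Real.exp_pos 1]

theorem le_div_sq_mul_log_add_log {C ε m : ℝ} (hC : 0 ≤ C) (hε0 : 0 < ε) (hε1 : ε ≤ 1)
    (hm0 : 0 < m) (hm4 : m ≤ 1 / 4) :
    C ≤ C / ε ^ 2 * (Real.log (1 / ε) + Real.log (1 / m)) := by
  have hlog : 0 ≤ Real.log (1 / ε) := Real.log_nonneg (one_le_one_div hε0 hε1)
  have hC' : C ≤ C / ε ^ 2 := le_div_self hC (by positivity) (pow_le_one₀ hε0.le hε1)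
  exact hC'.trans (le_mul_of_one_le_right (by positivity)
    (by linarith [one_le_log_one_div hm0 hm4]))

theorem half_add_ceil_mul_sqrt_le {ε : ℝ} (hε : ε ≤ 1) {n : ℕ} (hn : 4 ≤ n) :
    n / 2 + ⌈ε * √(n : ℝ)⌉₊ ≤ n := by
  have hn' : (4 : ℝ) ≤ n := mod_cast hn
  have hceil : ⌈ε * √(n : ℝ)⌉₊ ≤ n - n / 2 := by
    refine Nat.ceil_le.2 ?_
    calc ε * √(n : ℝ) ≤ √n := mul_le_of_le_one_left (Real.sqrt_nonneg _) hε
      _ ≤ n / 2 := Real.sqrt_le_iff.2 ⟨by positivity, by nlinarith⟩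
      _ ≤ (n - n / 2 : ℕ) := by
        rw [Nat.cast_sub (Nat.div_le_self _ _)]
        linarith [Nat.cast_div_le (α := ℝ) (m := n) (n := 2)]
  omega

theorem half_mul_div_log_mul_le {ε m d : ℝ} (hε0 : 0 < ε) (hε1 : ε ≤ 1) (hm0 : 0 < m)
    (hm4 : m ≤ 1 / 4) (hd : 0 ≤ d) (h : ε ^ 2 * m ≤ (1 + ε ^ 2) * d) :
    1 / 2 * (ε ^ 2 / Real.log (1 / (ε * m))) * m ≤ d := by
  have hlog : 1 ≤ Real.log (1 / (ε * m)) :=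
    one_le_log_one_div (mul_pos hε0 hm0) ((mul_le_of_le_one_left hm0.le hε1).trans hm4)
  calc 1 / 2 * (ε ^ 2 / Real.log (1 / (ε * m))) * m ≤ 1 / 2 * ε ^ 2 * m := by
        gcongr
        exact div_le_self (sq_nonneg ε) hlog
    _ ≤ 1 / 2 * ((1 + ε ^ 2) * d) := by linarith
    _ ≤ d := by nlinarith [pow_le_one₀ (n := 2) hε0.le hε1]

end Numerics

/-- `Finset.upShadow^[r] A` is the `r`-fold iterated upper shadow of `A`; the complement of `A` is
taken inside the middle layer, and shadows of order `r` live in the layer `n / 2 + r`. -/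
theorem theorem1 :
    ∃ C : ℝ, 0 < C ∧ ∃ c : ℝ, 0 < c ∧
      ∀ (ε : ℝ), 0 < ε → ε < 1 →
      ∀ (n : ℕ), Even n →
      ∀ (A : Finset (Finset (Fin n))), A ⊆ cubeLayer n (n / 2) →
        A ≠ ∅ → A ≠ cubeLayer n (n / 2) →
      ∀ (m : ℝ), m = layerMeasure n (n / 2) A * (1 - layerMeasure n (n / 2) A) →
        C / ε ^ 2 * (Real.log (1 / ε) + Real.log (1 / m)) ≤ (n : ℝ) →
      ∀ (r : ℕ), r = ⌈ε * √(n : ℝ)⌉₊ →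
        c * (ε ^ 2 / Real.log (1 / (ε * m))) * m ≤
          layerMeasure n (n / 2 + r)
            (Finset.upShadow^[r] A ∩ Finset.upShadow^[r] (cubeLayer n (n / 2) \ A)) := by
  refine ⟨4, by norm_num, 1 / 2, by norm_num, ?_⟩
  intro ε hε0 hε1 n _ A hA hne hne' m hm hn r hr
  have hm0 : 0 < m := hm ▸ layerMeasure_mul_one_sub_pos (Nat.div_le_self n 2) hA hne hne'
  have hm4 : m ≤ 1 / 4 := by
    rw [hm]
    nlinarith [sq_nonneg (layerMeasure n (n / 2) A - 1 / 2)]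
  have hn4 : 4 ≤ n :=
    mod_cast (le_div_sq_mul_log_add_log zero_le_four hε0 hε1.le hm0 hm4).trans hn
  have hr0 : 0 < r := hr ▸ Nat.ceil_pos.2 (by positivity)
  have hrn : n / 2 + r ≤ n := hr ▸ half_add_ceil_mul_sqrt_le hε1.le hn4
  refine half_mul_div_log_mul_le hε0 hε1.le hm0 hm4 (layerMeasure_nonneg _ _ _) ?_
  rw [hm]
  exact theorem1_general hε0.le hr0 (hr ▸ Nat.le_ceil _) hrn hA
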